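/- Let $n\ge 0$ and let $d_1,\dots,d_n\ge 2$ be integers, $D=[d_1]\times\dots\times[d_n]$. For $\mathbb F\in\{\mathbb R,\mathbb C\}$, a rank-one tensor in $\mathbb F^D$ is a tensor in the image of the map $\mathbb F^{d_1}\times\dots\times\mathbb F^{d_n}\to\mathbb F^D$, $(\theta_1,\dots,\theta_n)\mapsto\theta_1\otimes\dots\otimes\theta_n$ (so the zero tensor is allowed when $n\ge 1$). For $E\subseteq D$, a partial tensor $T_E\in\mathbb F^E$ is completable over $\mathbb F$ if it is the restriction to $E$ of a rank-one tensor in $\mathbb F^D$; a real partial tensor is completable over $\mathbb C$ if it is so when regarded as an element of $\mathbb C^E$. Let $A\in\{0,1\}^{(d_1+\dots+d_n)\times D}$ be the matrix whose column with index $(i_1,\dots,i_n)$ is $\sum_{j=1}^n e_{j,i_j}$, where $e_{j,k}$ ($j\in[n]$, $k\in[d_j]$) is the standard basis of $\mathbb Z^{d_1+\dots+d_n}$, and let $A_E$ be the submatrix of the columns with indices in $E$. The saturation of a subgroup $L\subseteq\mathbb Z^m$ is $\{v\in\mathbb Z^m : kv\in L \text{ for some nonzero integer } k\}$. For every subset $E\subseteq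 D$ the following are equivalent: (i) Every real partial tensor $T_E\in\mathbb R^E$ with nonzero entries which is completable over $\mathbb C$ is also completable over $\mathbb R$. (ii) The index of the lattice spanned by the columns of $A_E$ in its saturation is odd. Moreover, for every $E\subseteq D$, whether a real partial tensor $T_E\in\mathbb R^E$ with nonzero entries which is completable over $\mathbb C$ is also completable over $\mathbb R$ depends only on the signs of its entries: if $T_E,T_E'\in\mathbb R^E$ have nonzero entries, are both completable over $\mathbb C$, and have the same sign in every entry, then $T_E$ is completable over $\mathbb R$ if and only if $T_E'$ is. -/

import Mathlib

namespace RankOneCompletion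

/-- The index set `D = [d₁] × ⋯ × [dₙ]` of the entries of a tensor. -/
abbrev Idx {n : ℕ} (d : Fin n → ℕ) : Type := ∀ j : Fin n, Fin (d j)

/-- The entries of the tensor product `θ₁ ⊗ ⋯ ⊗ θₙ` of vectors `θⱼ ∈ F ^ dⱼ`. -/
def tensorOf {n : ℕ} {d : Fin n → ℕ} {F : Type*} [Field F]
    (θ : ∀ j : Fin n, Fin (d j) → F) : Idx d → F :=
  fun i => ∏ j, θ j (i j)

/-- The set of rank-one tensors in `F ^ D`: the image of `(θ₁, …, θₙ) ↦ θ₁ ⊗ ⋯ ⊗ θₙ`. -/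
def rankOneTensors {n : ℕ} (d : Fin n → ℕ) (F : Type*) [Field F] : Set (Idx d → F) :=
  Set.range (fun θ : ∀ j : Fin n, Fin (d j) → F => tensorOf θ)

/-- A partial tensor with index set `E` is completable over `F` if it is the restriction to `E`
of a rank-one tensor with entries in `F`. -/
def Completable {n : ℕ} {d : Fin n → ℕ} {F : Type*} [Field F] {E : Set (Idx d)}
    (t : E → F) : Prop :=
  ∃ T ∈ rankOneTensors d F, ∀ e : E, T e = t e

/-- A real partial tensor is completable over `ℝ`. -/
def RealCompletable {n : ℕ} {d : Fin n → ℕ} {E : Set (Idx d)} (t : E → ℝ) : Prop :=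
  Completable t

/-- A real partial tensor, regarded as a complex one, is completable over `ℂ`. -/
def ComplexCompletable {n : ℕ} {d : Fin n → ℕ} {E : Set (Idx d)} (t : E → ℝ) : Prop :=
  Completable (fun e => (t e : ℂ))

/-- The `(d₁ + ⋯ + dₙ) × D` matrix `A` whose column at `(i₁, …, iₙ)` is
`e_{1,i₁} + ⋯ + e_{n,iₙ}`. -/
def segreMatrix {n : ℕ} (d : Fin n → ℕ) : Matrix (Σ j : Fin n, Fin (d j)) (Idx d) ℤ :=
  Matrix.of fun p i => if i p.1 = p.2 then 1 else 0

/-- The submatrix `A_E` of the columns of `A` with indices in `E`. -/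
def segreSubmatrix {n : ℕ} {d : Fin n → ℕ} (E : Set (Idx d)) :
    Matrix (Σ j : Fin n, Fin (d j)) E ℤ :=
  (segreMatrix d).submatrix id (fun e : E => (e : Idx d))

/-- The lattice (subgroup of `ℤ ^ m`) spanned by the columns of an integer matrix. -/
def columnLattice {m k : Type*} (A : Matrix m k ℤ) : AddSubgroup (m → ℤ) :=
  AddSubgroup.closure (Set.range A.col)

/-- The saturation of a lattice `L ⊆ ℤ ^ m`: all integer vectors that have a nonzero integer
multiple in `L`, i.e. the integer points of the rational span of `L`. -/
def saturation {m : Type*} (L : AddSubgroup (m → ℤ)) : AddSubgroup (m → ℤ) where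
  carrier := {v | ∃ k : ℤ, k ≠ 0 ∧ k • v ∈ L}
  zero_mem' := ⟨1, one_ne_zero, by simp⟩
  add_mem' := by
    rintro v w ⟨k, hk, hv⟩ ⟨l, hl, hw⟩
    refine ⟨k * l, mul_ne_zero hk hl, ?_⟩
    have h : (k * l) • (v + w) = l • (k • v) + k • (l • w) := by
      rw [smul_smul, smul_smul, mul_comm l k, ← smul_add]
    rw [h]
    exact L.add_mem (L.zsmul_mem hv l) (L.zsmul_mem hw k)
  neg_mem' := by
    rintro v ⟨k, hk, hv⟩
    exact ⟨k, hk, by rw [smul_neg]; exact L.neg_mem hv⟩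

/-- The index of a lattice in its saturation. -/
noncomputable def saturationIndex {m : Type*} (L : AddSubgroup (m → ℤ)) : ℕ :=
  L.relIndex (saturation L)

end RankOneCompletion

/-! Without zero entries, completability over `K` means extending to a character `ℤ ^ m → Kˣ`
prescribed on the columns of `A_E`. Let `L` be the column lattice, `S` its saturation, `k` the
index. Signs decide: absolute values of complex factors complete `|t|` over `ℝ`, so only `t / |t|`
matters. If `k` is odd, `t ^ k` has the signs of `t`, and it is real completable because `k • S ⊆ L`
and `S` is a direct summand. If `k` is even, Cauchy's theorem gives `v ∉ L` with `2 • v ∈ L`. A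
complex character can be `±1` on `L` and `-1` at `2 • v`, whereas a real character is a square
there. -/

namespace RankOneCompletion

/-! ### Completions as characters, and dependence on signs -/

section Completion

variable {n : ℕ} {d : Fin n → ℕ}

/-- The homomorphism `ℤ ^ m → Kˣ` sending the basis vectors to given units. -/
noncomputable def torusHom {m K : Type*} [Fintype m] [Field K] (u : m → Kˣ) :
    (m → ℤ) →+ Additive Kˣ where
  toFun v := Additive.ofMul (∏ p, u p ^ v p)
  map_zero' := by simp
  map_add' v w := by
    simp [zpow_add, Finset.prod_mul_distrib]

theorem segreSubmatrix_col (E : Set (Idx d)) (e : E) :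
    (segreSubmatrix E).col e = ∑ j, Pi.single (⟨j, e.1 j⟩ : Σ j : Fin n, Fin (d j)) (1 : ℤ) := by
  classical
  ext ⟨j, k⟩
  simp only [segreSubmatrix, segreMatrix, Matrix.col_apply, Matrix.submatrix_apply, id,
    Matrix.of_apply, Finset.sum_apply]
  rw [Finset.sum_eq_single j]
  · by_cases h : e.1 j = k
    · subst h; simp
    · have : (⟨j, k⟩ : Σ j : Fin n, Fin (d j)) ≠ ⟨j, e.1 j⟩ := by
        intro h'; apply h; cases h'; rfl
      rw [if_neg h, Pi.single_eq_of_ne this]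
  · intro b _ hb
    have : (⟨j, k⟩ : Σ j : Fin n, Fin (d j)) ≠ ⟨b, e.1 b⟩ := by
      intro h'; apply hb; cases h'; rfl
    exact Pi.single_eq_of_ne this _
  · simp

/-- A partial tensor without zero entries is completable iff it is the restriction of a character
of `ℤ ^ (d₁ + ⋯ + dₙ)` to the columns of `A_E`. -/
theorem completable_iff_exists_hom {K : Type*} [Field K] {E : Set (Idx d)} {t : E → K}
    (ht : ∀ e, t e ≠ 0) :
    Completable t ↔ ∃ φ : ((Σ j : Fin n, Fin (d j)) → ℤ) →+ Additive Kˣ,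
      ∀ e, ((φ ((segreSubmatrix E).col e)).toMul : K) = t e := by
  classical
  constructor
  · rintro ⟨_, ⟨θ, rfl⟩, h⟩
    -- A zero coordinate of `θ` is never used by an entry in `E`, so the value `1` there is
    -- harmless.
    refine ⟨torusHom fun p => if h0 : θ p.1 p.2 = 0 then 1 else Units.mk0 _ h0, fun e => ?_⟩
    have hne : ∀ j, θ j (e.1 j) ≠ 0 := by
      have h1 := ht e
      rw [← h e] at h1
      intro j
      exact (Finset.prod_ne_zero_iff.mp h1) j (Finset.mem_univ j)
    rw [← h e, segreSubmatrix_col, map_sum, toMul_sum, Units.coe_prod]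
    refine Finset.prod_congr rfl fun j _ => ?_
    simp only [torusHom, AddMonoidHom.coe_mk, ZeroHom.coe_mk, toMul_ofMul]
    rw [Finset.prod_eq_single (⟨j, e.1 j⟩ : Σ j : Fin n, Fin (d j))]
    · simp [hne j]
    · intro b _ hb
      simp [Pi.single_eq_of_ne hb]
    · simp
  · rintro ⟨φ, h⟩
    refine ⟨_, ⟨fun j k => ((φ (Pi.single ⟨j, k⟩ 1)).toMul : K), rfl⟩, fun e => ?_⟩
    rw [← h e, segreSubmatrix_col, map_sum, toMul_sum, Units.coe_prod]
    rfl

theorem Completable.mul {K : Type*} [Field K] {E : Set (Idx d)} {t t' : E → K}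
    (h : Completable t) (h' : Completable t') : Completable fun e => t e * t' e := by
  obtain ⟨_, ⟨θ, rfl⟩, h⟩ := h
  obtain ⟨_, ⟨θ', rfl⟩, h'⟩ := h'
  refine ⟨_, ⟨fun j k => θ j k * θ' j k, rfl⟩, fun e => ?_⟩
  simp only [tensorOf, ← h e, ← h' e, Finset.prod_mul_distrib]

theorem Completable.inv {K : Type*} [Field K] {E : Set (Idx d)} {t : E → K}
    (h : Completable t) : Completable fun e => (t e)⁻¹ := by
  obtain ⟨_, ⟨θ, rfl⟩, h⟩ := h
  refine ⟨_, ⟨fun j k => (θ j k)⁻¹, rfl⟩, fun e => ?_⟩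
  simp only [tensorOf, ← h e, Finset.prod_inv_distrib]

theorem Completable.pow {K : Type*} [Field K] {E : Set (Idx d)} {t : E → K}
    (h : Completable t) (k : ℕ) : Completable fun e => t e ^ k := by
  obtain ⟨_, ⟨θ, rfl⟩, h⟩ := h
  refine ⟨_, ⟨fun j i => θ j i ^ k, rfl⟩, fun e => ?_⟩
  simp only [tensorOf, ← h e, Finset.prod_pow]

theorem ComplexCompletable.abs {E : Set (Idx d)} {t : E → ℝ} (h : ComplexCompletable t) :
    RealCompletable fun e => |t e| := by
  obtain ⟨_, ⟨θ, rfl⟩, h⟩ := h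
  refine ⟨_, ⟨fun j i => ‖θ j i‖, rfl⟩, fun e => ?_⟩
  change _ = |t e|
  rw [← Real.norm_eq_abs, ← Complex.norm_real]
  refine Eq.trans ?_ (congrArg norm (h e))
  simp [tensorOf, norm_prod]

/-- Among the complex completable partial tensors without zero entries, real completability
depends only on the signs of the entries. -/
theorem RealCompletable.of_sign_eq {E : Set (Idx d)} {t t' : E → ℝ}
    (ht : ∀ e, t e ≠ 0) (hc : ComplexCompletable t)
    (hc' : ComplexCompletable t') (hs : ∀ e, SignType.sign (t e) = SignType.sign (t' e))
    (h : RealCompletable t) : RealCompletable t' := by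
  have key := Completable.mul (Completable.mul h (Completable.inv hc.abs)) hc'.abs
  have heq : (fun e => t e * |t e|⁻¹ * |t' e|) = t' := by
    funext e
    have h1 : |t e| ≠ 0 := abs_ne_zero.mpr (ht e)
    have h2 := sign_mul_abs (t e)
    have h3 := sign_mul_abs (t' e)
    rw [← hs e] at h3
    have h4 : t e * |t e|⁻¹ = SignType.sign (t e) := by
      rw [← div_eq_mul_inv, div_eq_iff h1, h2]
    rw [h4, h3]
  rwa [heq] at key

end Completion

/-! ### Lattices, saturations and separating characters -/

section Saturation

variable {m : Type*}

theorem le_saturation (L : AddSubgroup (m → ℤ)) : L ≤ saturation L :=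
  fun v hv => ⟨1, one_ne_zero, by simpa using hv⟩

/-- A saturated sublattice of `ℤ ^ m` is the image of a projection. -/
theorem exists_retraction_saturation [Finite m] (L : AddSubgroup (m → ℤ)) :
    ∃ p : (m → ℤ) →+ (m → ℤ), (∀ v, p v ∈ saturation L) ∧ ∀ v ∈ saturation L, p v = v := by
  let S : Submodule ℤ (m → ℤ) := AddSubgroup.toIntSubmodule (saturation L)
  have hS : ∀ v, v ∈ S ↔ v ∈ saturation L := fun v => Iff.rfl
  -- The quotient by a saturated lattice is torsion-free and finitely generated, hence free, so the
  -- quotient map splits.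
  have htf : Module.IsTorsionFree ℤ ((m → ℤ) ⧸ S) := by
    refine Module.IsTorsionFree.of_smul_eq_zero fun k x h => ?_
    by_cases hk : k = 0
    · exact Or.inl hk
    right
    induction x using Submodule.Quotient.induction_on with | _ v =>
    rw [← Submodule.Quotient.mk_smul, Submodule.Quotient.mk_eq_zero] at h
    rw [Submodule.Quotient.mk_eq_zero]
    obtain ⟨l, hl, h⟩ := h
    exact ⟨l * k, mul_ne_zero hl hk, by rwa [mul_smul]⟩
  have hfree : Module.Free ℤ ((m → ℤ) ⧸ S) := inferInstance
  obtain ⟨s, hs⟩ := Module.projective_lifting_property S.mkQ LinearMap.id S.mkQ_surjective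
  refine ⟨(LinearMap.id - s.comp S.mkQ).toAddMonoidHom, fun v => ?_, fun v hv => ?_⟩
  · rw [← hS, ← Submodule.Quotient.mk_eq_zero, ← Submodule.mkQ_apply]
    have := LinearMap.congr_fun hs (S.mkQ v)
    simp only [LinearMap.comp_apply, LinearMap.id_apply] at this
    simp [this, -Submodule.mkQ_apply]
  · have : S.mkQ v = 0 := (Submodule.Quotient.mk_eq_zero S).mpr hv
    simp [this, -Submodule.mkQ_apply]

theorem saturationIndex_smul_mem {L : AddSubgroup (m → ℤ)} {v : m → ℤ} (hv : v ∈ saturation L) :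
    saturationIndex L • v ∈ L :=
  AddSubgroup.nsmul_index_mem (L.addSubgroupOf (saturation L)) ⟨v, hv⟩

/-- The quotient is finitely generated and torsion. Finiteness is what permits Cauchy's theorem for
even index. -/
theorem finite_saturation_quotient [Finite m] (L : AddSubgroup (m → ℤ)) :
    Finite (saturation L ⧸ L.addSubgroupOf (saturation L)) := by
  have hfg : AddGroup.FG (saturation L) := Module.Finite.iff_addGroup_fg.mp
    (inferInstance : Module.Finite ℤ (AddSubgroup.toIntSubmodule (saturation L)))
  have hfg' : AddGroup.FG (saturation L ⧸ L.addSubgroupOf (saturation L)) := inferInstance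
  have : Module.Finite ℤ (saturation L ⧸ L.addSubgroupOf (saturation L)) :=
    Module.Finite.iff_addGroup_fg.mpr hfg'
  refine Module.finite_of_fg_torsion _ fun x => ?_
  induction x using QuotientAddGroup.induction_on with | _ v =>
  obtain ⟨v, k, hk, h⟩ := v
  refine ⟨⟨k, mem_nonZeroDivisors_of_ne_zero hk⟩, ?_⟩
  change k • (QuotientAddGroup.mk _ : saturation L ⧸ L.addSubgroupOf (saturation L)) = _
  rw [← QuotientAddGroup.mk_zsmul, QuotientAddGroup.eq_zero_iff]
  exact h

/-- If the index of `L` in its saturation is not odd, then some element of `L` is twice an integer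
vector outside `L`. -/
theorem exists_two_smul_mem_of_not_odd [Finite m] {L : AddSubgroup (m → ℤ)}
    (h : ¬ Odd (saturationIndex L)) : ∃ v, v ∉ L ∧ 2 • v ∈ L := by
  have hfin := finite_saturation_quotient L
  rw [Nat.not_odd_iff_even, even_iff_two_dvd] at h
  have : Fact (Nat.Prime 2) := ⟨Nat.prime_two⟩
  obtain ⟨x, hx⟩ := exists_prime_addOrderOf_dvd_card' 2
    (G := saturation L ⧸ L.addSubgroupOf (saturation L)) h
  induction x using QuotientAddGroup.induction_on with | _ v =>
  refine ⟨v, fun hv => ?_, ?_⟩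
  · have : (v : saturation L ⧸ L.addSubgroupOf (saturation L)) = 0 :=
      (QuotientAddGroup.eq_zero_iff _).mpr hv
    rw [this] at hx
    simp at hx
  · have h2 := addOrderOf_nsmul_eq_zero (v : saturation L ⧸ L.addSubgroupOf (saturation L))
    rw [hx, ← QuotientAddGroup.mk_nsmul, QuotientAddGroup.eq_zero_iff] at h2
    exact h2

/-- The character `x ↦ exp (2πix)` of `ℚ / ℤ`. -/
noncomputable def expHom : AddCircle (1 : ℚ) →+ Additive ℂˣ :=
  QuotientAddGroup.lift _
    { toFun := fun x : ℚ => Additive.ofMul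
        (Units.mk0 (Complex.exp (2 * Real.pi * Complex.I * x)) (Complex.exp_ne_zero _))
      map_zero' := by
        apply Additive.toMul.injective
        ext
        simp
      map_add' := fun x y => by
        apply Additive.toMul.injective
        ext
        simp [mul_add, Complex.exp_add] }
    (by
      intro x hx
      obtain ⟨k, rfl⟩ := AddSubgroup.mem_zmultiples_iff.mp hx
      apply Additive.toMul.injective
      ext
      simp only [AddMonoidHom.coe_mk, ZeroHom.coe_mk, toMul_ofMul, Units.val_mk0, toMul_zero,
        Units.val_one]
      rw [Complex.exp_eq_one_iff]
      exact ⟨k, by push_cast [zsmul_eq_mul]; ring⟩)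

theorem expHom_injective : Function.Injective expHom := by
  rw [injective_iff_map_eq_zero]
  intro x hx
  induction x using QuotientAddGroup.induction_on with | _ q =>
  have h1 : Complex.exp (2 * Real.pi * Complex.I * q) = 1 :=
    congrArg (fun z : Additive ℂˣ => (z.toMul : ℂ)) hx
  obtain ⟨k, hk⟩ := Complex.exp_eq_one_iff.mp h1
  rw [mul_comm] at hk
  have hq : (q : ℂ) = k := mul_right_cancel₀ Complex.two_pi_I_ne_zero hk
  rw [QuotientAddGroup.eq_zero_iff, AddSubgroup.mem_zmultiples_iff]
  refine ⟨k, ?_⟩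
  have : q = k := by exact_mod_cast hq
  simp [this]

/-- If `v ∉ L`, some complex character takes values `±1` on `L` and is not `1` at `2v`. -/
theorem exists_character_sq_eq_one {L : AddSubgroup (m → ℤ)} {v : m → ℤ} (hv : v ∉ L) :
    ∃ φ : (m → ℤ) →+ Additive ℂˣ, (∀ w ∈ L, 2 • φ w = 0) ∧ φ (2 • v) ≠ 0 := by
  -- With `M = 2L`, a character trivial on `M` is `±1` on `L`. Since doubling is injective, `v ∉ L`
  -- gives `2 • v ∉ M`.
  let M : AddSubgroup (m → ℤ) := L.map (nsmulAddMonoidHom 2)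
  have hne : ((2 • v : m → ℤ) : (m → ℤ) ⧸ M) ≠ 0 := by
    rw [Ne, QuotientAddGroup.eq_zero_iff]
    rintro ⟨w, hw, h⟩
    apply hv
    have : w = v := smul_right_injective (m → ℤ) (two_ne_zero' ℕ) h
    exact this ▸ hw
  obtain ⟨c, hc⟩ := CharacterModule.exists_character_apply_ne_zero_of_ne_zero hne
  refine ⟨expHom.comp ((c : ((m → ℤ) ⧸ M) →+ AddCircle (1 : ℚ)).comp (QuotientAddGroup.mk' M)),
    fun w hw => ?_, fun h => hc ?_⟩
  · rw [← map_nsmul]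
    have : QuotientAddGroup.mk' M (2 • w) = 0 :=
      (QuotientAddGroup.eq_zero_iff _).mpr ⟨w, hw, rfl⟩
    exact (congrArg (fun x => expHom (c x)) this).trans
      ((congrArg expHom (map_zero c)).trans (map_zero _))
  · exact expHom_injective (h.trans (map_zero _).symm)

end Saturation

/-! ### Parity of the index and real completability -/

section Index

variable {n : ℕ} {d : Fin n → ℕ} {E : Set (Idx d)}

theorem col_mem_columnLattice {m k : Type*} (A : Matrix m k ℤ) (e : k) :
    A.col e ∈ columnLattice A :=
  AddSubgroup.subset_closure ⟨e, rfl⟩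

/-- Two homomorphisms that agree on the columns agree on the column lattice. -/
theorem eqOn_columnLattice {m k G : Type*} [AddGroup G] {A : Matrix m k ℤ}
    {φ ψ : (m → ℤ) →+ G} (h : ∀ e, φ (A.col e) = ψ (A.col e)) {v : m → ℤ}
    (hv : v ∈ columnLattice A) : φ v = ψ v := by
  have : columnLattice A ≤ φ.eqLocus ψ := by
    rw [columnLattice, AddSubgroup.closure_le]
    rintro _ ⟨e, rfl⟩
    exact h e
  exact this hv

/-- Complexification of real units, written additively. -/
noncomputable def complexUnits : Additive ℝˣ →+ Additive ℂˣ :=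
  MonoidHom.toAdditive (Units.map (Complex.ofRealHom : ℝ →* ℂ))

theorem complexUnits_coe (x : Additive ℝˣ) :
    ((complexUnits x).toMul : ℂ) = ((x.toMul : ℝ) : ℂ) := rfl

theorem complexUnits_injective : Function.Injective complexUnits := by
  intro x y h
  apply Additive.toMul.injective
  ext
  have : ((complexUnits x).toMul : ℂ) = ((complexUnits y).toMul : ℂ) := by rw [h]
  rw [complexUnits_coe, complexUnits_coe] at this
  exact_mod_cast this

theorem realCompletable_pow_saturationIndex {t : E → ℝ} (ht : ∀ e, t e ≠ 0)
    (hc : ComplexCompletable t) :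
    RealCompletable fun e => t e ^ saturationIndex (columnLattice (segreSubmatrix E)) := by
  set L := columnLattice (segreSubmatrix E) with hL
  obtain ⟨φ, hφ⟩ := (completable_iff_exists_hom
    (fun e => Complex.ofReal_ne_zero.mpr (ht e))).mp hc
  obtain ⟨p, hp, hp'⟩ := exists_retraction_saturation L
  have hreal : ∀ v ∈ L, φ v ∈ complexUnits.range := by
    have : L ≤ complexUnits.range.comap φ := by
      rw [hL, columnLattice, AddSubgroup.closure_le]
      rintro _ ⟨e, rfl⟩
      refine ⟨Additive.ofMul (Units.mk0 (t e) (ht e)), ?_⟩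
      apply Additive.toMul.injective
      ext
      rw [hφ e]
      rfl
    exact this
  -- Projecting to the saturation and multiplying by the index lands in `L`, where `φ` is real. On
  -- columns the projection is the identity, leaving the power of `φ`.
  let φ' : ((Σ j : Fin n, Fin (d j)) → ℤ) →+ complexUnits.range :=
    (φ.comp ((nsmulAddMonoidHom (saturationIndex L)).comp p)).codRestrict _
      fun v => hreal _ (saturationIndex_smul_mem (hp v))
  let ε := AddMonoidHom.ofInjective complexUnits_injective
  refine (completable_iff_exists_hom fun e => pow_ne_zero _ (ht e)).mpr
    ⟨ε.symm.toAddMonoidHom.comp φ', fun e => ?_⟩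
  have hcol := hp' _ (le_saturation L (col_mem_columnLattice (segreSubmatrix E) e))
  have h1 : complexUnits (ε.symm (φ' ((segreSubmatrix E).col e))) =
      saturationIndex L • φ ((segreSubmatrix E).col e) := by
    have : (ε (ε.symm (φ' ((segreSubmatrix E).col e))) : Additive ℂˣ) =
        φ' ((segreSubmatrix E).col e) := by rw [ε.apply_symm_apply]
    refine this.trans ?_
    change φ (saturationIndex L • p _) = _
    rw [hcol, map_nsmul]
  have h2 := congrArg (fun z : Additive ℂˣ => (z.toMul : ℂ)) h1
  simp only [complexUnits_coe, toMul_nsmul, Units.val_pow_eq_pow_val, hφ e] at h2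
  exact_mod_cast h2

theorem sign_pow_of_odd {k : ℕ} (hk : Odd k) (x : ℝ) :
    SignType.sign (x ^ k) = SignType.sign x := by
  rcases lt_trichotomy x 0 with h | h | h
  · rw [sign_neg h, sign_neg (hk.pow_neg h)]
  · rw [h, zero_pow hk.pos.ne']
  · rw [sign_pos h, sign_pos (pow_pos h k)]

theorem exists_complexCompletable_not_realCompletable
    (h : ¬ Odd (saturationIndex (columnLattice (segreSubmatrix E)))) :
    ∃ t : E → ℝ, (∀ e, t e ≠ 0) ∧ ComplexCompletable t ∧ ¬ RealCompletable t := by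
  obtain ⟨v, hv, hv2⟩ := exists_two_smul_mem_of_not_odd h
  obtain ⟨φ, hφ, hφv⟩ := exists_character_sq_eq_one hv
  have hval : ∀ w ∈ columnLattice (segreSubmatrix E),
      ((φ w).toMul : ℂ) = 1 ∨ ((φ w).toMul : ℂ) = -1 := by
    intro w hw
    have := congrArg (fun z : Additive ℂˣ => (z.toMul : ℂ)) (hφ w hw)
    exact sq_eq_one_iff.mp (by simpa using this)
  have hsign : ∀ e : E, ∃ s : ℝ, s ≠ 0 ∧
      ((φ ((segreSubmatrix E).col e)).toMul : ℂ) = s := by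
    intro e
    rcases hval _ (col_mem_columnLattice _ e) with h1 | h1
    · exact ⟨1, one_ne_zero, by simpa using h1⟩
    · exact ⟨-1, by norm_num, by simpa using h1⟩
  choose t ht hφt using hsign
  refine ⟨t, ht, (completable_iff_exists_hom
    (fun e => Complex.ofReal_ne_zero.mpr (ht e))).mpr ⟨φ, hφt⟩, fun hr => ?_⟩
  obtain ⟨ψ, hψ⟩ := (completable_iff_exists_hom ht).mp hr
  have heq : φ (2 • v) = (complexUnits.comp ψ) (2 • v) := by
    refine eqOn_columnLattice (fun e => ?_) hv2
    apply Additive.toMul.injective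
    ext
    rw [hφt e, AddMonoidHom.comp_apply, complexUnits_coe, hψ e]
  -- `v` need not lie in `L`, but `ψ` is defined on all of `ℤ ^ m`, so its value at `2 • v` is a
  -- real square and cannot be `-1`.
  have hsq : ((φ (2 • v)).toMul : ℂ) = (((ψ v).toMul : ℝ) ^ 2 : ℝ) := by
    rw [heq, AddMonoidHom.comp_apply, complexUnits_coe, map_nsmul]
    simp
  rcases hval _ hv2 with h1 | h1
  · apply hφv
    apply Additive.toMul.injective
    ext
    simpa using h1
  · rw [h1] at hsq
    have : (-1 : ℝ) = ((ψ v).toMul : ℝ) ^ 2 := by exact_mod_cast hsq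
    nlinarith [sq_nonneg ((ψ v).toMul : ℝ)]

end Index

end RankOneCompletion

theorem mainTheorem4 {n : ℕ} (d : Fin n → ℕ) (hd : ∀ j, 2 ≤ d j)
    (E : Set (RankOneCompletion.Idx d)) :
    ((∀ t : E → ℝ, (∀ e, t e ≠ 0) →
        RankOneCompletion.ComplexCompletable t → RankOneCompletion.RealCompletable t) ↔
      Odd (RankOneCompletion.saturationIndex
        (RankOneCompletion.columnLattice (RankOneCompletion.segreSubmatrix E)))) ∧
    (∀ t t' : E → ℝ, (∀ e, t e ≠ 0) → (∀ e, t' e ≠ 0) →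
      RankOneCompletion.ComplexCompletable t → RankOneCompletion.ComplexCompletable t' →
      (∀ e, SignType.sign (t e) = SignType.sign (t' e)) →
      (RankOneCompletion.RealCompletable t ↔ RankOneCompletion.RealCompletable t')) := by
  refine ⟨⟨fun h => ?_, fun hodd t ht hc => ?_⟩, fun t t' ht ht' hc hc' hs =>
    ⟨.of_sign_eq ht hc hc' hs, .of_sign_eq ht' hc' hc fun e => (hs e).symm⟩⟩
  · by_contra hodd
    obtain ⟨t, ht, hc, hr⟩ :=
      RankOneCompletion.exists_complexCompletable_not_realCompletable hodd
    exact hr (h t ht hc)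
  · refine .of_sign_eq (fun e => pow_ne_zero _ (ht e)) ?_ hc
      (fun e => RankOneCompletion.sign_pow_of_odd hodd (t e))
      (RankOneCompletion.realCompletable_pow_saturationIndex ht hc)
    simpa [RankOneCompletion.ComplexCompletable] using RankOneCompletion.Completable.pow hc _
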